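/- Let $d\ge 0$ and let $R_d=\mathbb{Z}[u_1^{\pm1},\dots,u_d^{\pm1}]$ be the ring of Laurent polynomials with integer coefficients in $d$ commuting variables. For $\mathbf n=(n_1,\dots,n_d)\in\mathbb{Z}^d$ write $u^{\mathbf n}=u_1^{n_1}\cdots u_d^{n_d}$. Let $M$ be an $R_d$-module, regarded as a discrete abelian group, and let $X_M=\widehat M$ be its compact Pontryagin dual. The algebraic $\mathbb{Z}^d$-action $\alpha_M$ on $X_M$ is the action by continuous automorphisms in which $\alpha_M^{\mathbf n}$ is dual to multiplication by $u^{\mathbf n}$ on $M$, that is, $(\alpha_M^{\mathbf n}x)(m)=x(u^{\mathbf n}m)$ for $x\in X_M$ and $m\in M$. The action $\alpha_M$ is called Noetherian if $M$ is a Noetherian $R_d$-module. It is called ergodic if every measurable subset of $X_M$ that is invariant under all the $\alpha_M^{\mathbf n}$, $\mathbf n\in\mathbb{Z}^d$, has Haar measure $0$ or full Haar measure. Suppose that $\alpha_M$ is a Noetherian and ergodic algebraic $\mathbb{Z}^d$-action and let $\mathbf n\in\mathbb{Z}^d$. If for every integer $j\ge 1$ the set $$F_j(\alpha_M^{\mathbf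 n})=\{x\in X_M \mid (\alpha_M^{\mathbf n})^{j}x=x\}$$ of points of period $j$ is finite, then the single automorphism $\alpha_M^{\mathbf n}$ is ergodic with respect to Haar measure. -/

import Mathlib

open MeasureTheory

namespace AlgebraicAction

/-- The ring `R_d = ℤ[u₁^{±1}, …, u_d^{±1}]` of integer Laurent polynomials in `d` commuting
variables, as the integral group ring of `ℤ^d`. -/
abbrev LaurentRing (d : ℕ) : Type := AddMonoidAlgebra ℤ (Fin d → ℤ)

/-- The monomial `u^n = u₁^{n₁} ⋯ u_d^{n_d}`. -/
noncomputable def monomial {d : ℕ} (n : Fin d → ℤ) : LaurentRing d :=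
  AddMonoidAlgebra.single n 1

theorem monomial_zero {d : ℕ} : monomial (0 : Fin d → ℤ) = 1 := rfl

theorem monomial_add {d : ℕ} (m n : Fin d → ℤ) :
    monomial (m + n) = monomial m * monomial n := by
  simp [monomial, AddMonoidAlgebra.single_mul_single]

/-- The compact abelian group dual to the (discrete) abelian group `M`: all characters
`M → 𝕊¹`, with the compact-open topology. It is written multiplicatively. -/
abbrev DualGroup (M : Type*) [AddCommGroup M] [TopologicalSpace M] : Type _ :=
  PontryaginDual (Multiplicative M)

section Dual

variable (M : Type*) [AddCommGroup M] [TopologicalSpace M]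

noncomputable instance : MeasurableSpace (DualGroup M) := borel _

instance : BorelSpace (DualGroup M) := ⟨rfl⟩

/-- The Haar measure of the compact group dual to `M`, normalized to total mass one. -/
noncomputable def haar [DiscreteTopology M] : Measure (DualGroup M) :=
  Measure.haarMeasure ⊤

end Dual

section Action

variable {d : ℕ} (M : Type*) [AddCommGroup M] [Module (LaurentRing d) M]
  [TopologicalSpace M] [DiscreteTopology M]

/-- Multiplication by the monomial `u^n` on the discrete module `M`. -/
noncomputable def mulMonomial (n : Fin d → ℤ) : Multiplicative M →ₜ* Multiplicative M where
  toMonoidHom := AddMonoidHom.toMultiplicative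
    (DistribSMul.toAddMonoidHom M (monomial n))
  continuous_toFun := continuous_of_discreteTopology

/-- The dual of multiplication by `u^n`, that is `x ↦ (m ↦ x (u^n m))`. -/
noncomputable def dualMap (n : Fin d → ℤ) : DualGroup M →ₜ* DualGroup M :=
  PontryaginDual.map (mulMonomial M n)

theorem dualMap_apply (n : Fin d → ℤ) (x : DualGroup M) (m : M) :
    dualMap M n x (Multiplicative.ofAdd m) = x (Multiplicative.ofAdd (monomial n • m)) :=
  rfl

theorem dualMap_zero (x : DualGroup M) : dualMap M (0 : Fin d → ℤ) x = x := by
  refine PontryaginDual.ext fun m => ?_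
  have h := dualMap_apply M (0 : Fin d → ℤ) x m.toAdd
  rw [monomial_zero, one_smul] at h
  exact h

theorem dualMap_add (n k : Fin d → ℤ) (x : DualGroup M) :
    dualMap M (n + k) x = dualMap M n (dualMap M k x) := by
  refine PontryaginDual.ext fun m => ?_
  have h := dualMap_apply M (n + k) x m.toAdd
  rw [add_comm n k, monomial_add, mul_smul] at h
  rw [add_comm n k]
  exact h

/-- The algebraic `ℤ^d`-action `α_M` attached to the `R_d`-module `M`: the continuous
automorphism `α_M^n` of the dual group of `M` is dual to multiplication by `u^n` on `M`. -/
noncomputable def alpha (n : Fin d → ℤ) : DualGroup M ≃ₜ* DualGroup M where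
  toFun := dualMap M n
  invFun := dualMap M (-n)
  left_inv x := by rw [← dualMap_add, neg_add_cancel, dualMap_zero]
  right_inv x := by rw [← dualMap_add, add_neg_cancel, dualMap_zero]
  map_mul' := map_mul (dualMap M n)
  continuous_toFun := (dualMap M n).continuous_toFun
  continuous_invFun := (dualMap M (-n)).continuous_toFun

theorem alpha_apply (n : Fin d → ℤ) (x : DualGroup M) (m : M) :
    alpha M n x (Multiplicative.ofAdd m) = x (Multiplicative.ofAdd (monomial n • m)) :=
  rfl

theorem alpha_zero (x : DualGroup M) : alpha M (0 : Fin d → ℤ) x = x :=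
  dualMap_zero M x

theorem alpha_add (n k : Fin d → ℤ) (x : DualGroup M) :
    alpha M (n + k) x = alpha M n (alpha M k x) :=
  dualMap_add M n k x

variable (d) in
/-- The whole action `α_M` is ergodic for Haar measure: every measurable set that is invariant
under all `α_M^n`, `n ∈ ℤ^d`, is null or conull. -/
def IsErgodicAction : Prop :=
  ∀ s : Set (DualGroup M), MeasurableSet s →
    (∀ n : Fin d → ℤ, alpha M n ⁻¹' s = s) → haar M s = 0 ∨ haar M sᶜ = 0

end Action

end AlgebraicAction

/-! Duality turns both hypotheses into algebra on $M$. Points of period $j$ are the characters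
killing $(u^{j\mathbf n}-1)M$, so finiteness gives this submodule finite index. For Noetherian $M$,
a Fitting argument then makes the kernel of $u^{j\mathbf n}-1$ finite
(`finite_ker_of_finite_quotient_range`). A nonzero finite submodule would have a clopen, invariant,
proper annihilator, contradicting ergodicity of the action (`IsErgodicAction.eq_bot_of_finite`), so
the kernel vanishes. Hence $u^{\mathbf n}$ has no nonzero periodic point in $M$. The Fourier
coefficients of an invariant set are constant along the resulting infinite orbits, so all but the
trivial one vanish (`ergodic_alpha_of_forall_pow_smul_ne`). -/

namespace AlgebraicAction

/-! ### Circle-valued characters of abstract abelian groups. -/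

section Characters

/-- The embedding of `ℚ / ℤ` into `ℝ / ℤ`. -/
noncomputable def ratAddCircleHom : AddCircle (1 : ℚ) →+ AddCircle (1 : ℝ) :=
  QuotientAddGroup.map _ _ (Rat.castHom ℝ).toAddMonoidHom <| by
    rw [AddSubgroup.zmultiples_le]
    exact ⟨1, by simp⟩

theorem ratAddCircleHom_injective : Function.Injective ratAddCircleHom := by
  rw [injective_iff_map_eq_zero]
  intro a ha
  induction a using QuotientAddGroup.induction_on with
  | H q =>
    have h : ((q : ℝ) : AddCircle (1 : ℝ)) = 0 := ha
    rw [AddCircle.coe_eq_zero_iff] at h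
    obtain ⟨k, hk⟩ := h
    refine (AddCircle.coe_eq_zero_iff (1 : ℚ)).2 ⟨k, ?_⟩
    have : (k : ℝ) = q := by simpa using hk
    simpa using (by exact_mod_cast this : (k : ℚ) = q)

/-- Characters with values in the circle separate the points of an abelian group. -/
theorem exists_circleHom_ne_one {A : Type*} [AddCommGroup A] {a : A} (ha : a ≠ 0) :
    ∃ f : Multiplicative A →* Circle, f (Multiplicative.ofAdd a) ≠ 1 := by
  obtain ⟨c, hc⟩ := CharacterModule.exists_character_apply_ne_zero_of_ne_zero ha
  refine ⟨{ toFun := fun b => AddCircle.toCircle (ratAddCircleHom (c b.toAdd))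
            map_one' := by simp
            map_mul' := fun b b' => by simp [AddCircle.toCircle_add] }, fun h => hc ?_⟩
  apply ratAddCircleHom_injective
  apply AddCircle.injective_toCircle one_ne_zero
  simpa using h

theorem finite_circle_pow_eq_one {k : ℕ} (hk : 0 < k) : {z : Circle | z ^ k = 1}.Finite := by
  refine Set.Finite.of_finite_image (f := fun z : Circle => (z : ℂ)) ?_
    Subtype.val_injective.injOn
  refine (Polynomial.nthRoots k (1 : ℂ)).toFinset.finite_toSet.subset ?_
  rintro _ ⟨z, hz, rfl⟩
  have : (z : ℂ) ^ k = 1 := by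
    rw [← Circle.coe_pow, show z ^ k = 1 from hz, Circle.coe_one]
  simpa [Polynomial.mem_nthRoots hk] using this

/-- An abelian group with finitely many characters is finite. -/
theorem finite_of_finite_circleHom {A : Type*} [AddCommGroup A]
    [Finite (Multiplicative A →* Circle)] : Finite A := by
  set k := Nat.card (Multiplicative A →* Circle) with hk
  have : NeZero k := ⟨Nat.card_pos.ne'⟩
  -- The order `k` of the character group kills every character, so all values are `k`-th roots of
  -- unity.
  have hpow (f : Multiplicative A →* Circle) (a : Multiplicative A) : f a ^ k = 1 := by
    rw [← MonoidHom.pow_apply, hk, pow_card_eq_one', MonoidHom.one_apply]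
  have := (finite_circle_pow_eq_one (NeZero.pos k)).to_subtype
  refine Finite.of_injective
    (fun (a : A) (f : Multiplicative A →* Circle) =>
      (⟨f (Multiplicative.ofAdd a), hpow f _⟩ : {z : Circle | z ^ k = 1})) fun a b hab => ?_
  by_contra hne
  obtain ⟨f, hf⟩ := exists_circleHom_ne_one (sub_ne_zero.2 hne)
  have h : f (Multiplicative.ofAdd a) = f (Multiplicative.ofAdd b) :=
    congrArg Subtype.val (congrFun hab f)
  rw [ofAdd_sub, map_div, h, div_self'] at hf
  exact hf rfl

end Characters

/-! ### Fourier analysis on the compact dual group. -/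

section DualGroup

variable {M : Type*} [AddCommGroup M] [TopologicalSpace M]

theorem continuous_dualGroup_apply (m : M) :
    Continuous fun x : DualGroup M => x (Multiplicative.ofAdd m) :=
  continuous_eval_const (F := Multiplicative M →ₜ* Circle) (Multiplicative.ofAdd m)

/-- The continuous function `x ↦ x m` on the dual group. -/
noncomputable def evalChar (m : M) : C(DualGroup M, ℂ) where
  toFun x := (x (Multiplicative.ofAdd m) : ℂ)
  continuous_toFun := continuous_subtype_val.comp (continuous_dualGroup_apply m)

theorem evalChar_apply (m : M) (x : DualGroup M) :
    evalChar m x = (x (Multiplicative.ofAdd m) : ℂ) := rfl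

theorem evalChar_zero : evalChar (0 : M) = 1 := by
  ext x
  simp [evalChar_apply]

theorem evalChar_add (m m' : M) : evalChar (m + m') = evalChar m * evalChar m' := by
  ext x
  simp [evalChar_apply]

theorem evalChar_neg (m : M) : evalChar (-m) = star (evalChar m) := by
  ext x
  rw [ContinuousMap.star_apply, evalChar_apply, evalChar_apply, ofAdd_neg, map_inv]
  exact Circle.coe_inv_eq_conj _

/-- The span of the evaluation characters, as a star subalgebra. -/
noncomputable def evalCharSubalgebra (M : Type*) [AddCommGroup M] [TopologicalSpace M] :
    StarSubalgebra ℂ C(DualGroup M, ℂ) where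
  toSubalgebra := Algebra.adjoin ℂ (Set.range evalChar)
  star_mem' := by
    change Algebra.adjoin ℂ (Set.range evalChar) ≤ star (Algebra.adjoin ℂ (Set.range evalChar))
    refine Algebra.adjoin_le ?_
    rintro - ⟨m, rfl⟩
    exact Algebra.subset_adjoin ⟨-m, evalChar_neg m⟩

theorem evalCharSubalgebra_coe :
    Subalgebra.toSubmodule (evalCharSubalgebra M).toSubalgebra =
      Submodule.span ℂ (Set.range evalChar) := by
  apply Algebra.adjoin_eq_span_of_subset
  refine Set.Subset.trans ?_ Submodule.subset_span
  intro x hx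
  refine Submonoid.closure_induction (fun _ => id) ⟨0, evalChar_zero⟩ ?_ hx
  rintro - - - - ⟨m, rfl⟩ ⟨m', rfl⟩
  exact ⟨m + m', evalChar_add m m'⟩

theorem evalCharSubalgebra_separatesPoints :
    (evalCharSubalgebra M).SeparatesPoints := by
  intro x y hxy
  obtain ⟨m, hm⟩ : ∃ m : M, x (Multiplicative.ofAdd m) ≠ y (Multiplicative.ofAdd m) := by
    by_contra! h
    exact hxy (PontryaginDual.ext fun a => h a.toAdd)
  exact ⟨_, ⟨evalChar m, Algebra.subset_adjoin ⟨m, rfl⟩, rfl⟩, fun h => hm (Circle.ext h)⟩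

variable [DiscreteTopology M]

/-- Stone–Weierstrass; the span is already an algebra because products of evaluation characters are
evaluation characters. -/
theorem span_evalChar_closure_eq_top :
    (Submodule.span ℂ (Set.range (evalChar (M := M)))).topologicalClosure = ⊤ := by
  rw [← evalCharSubalgebra_coe]
  exact congrArg (Subalgebra.toSubmodule <| StarSubalgebra.toSubalgebra ·)
    (ContinuousMap.starSubalgebra_topologicalClosure_eq_top_of_separatesPoints
      (evalCharSubalgebra M) evalCharSubalgebra_separatesPoints)

instance : (haar M).IsHaarMeasure := inferInstanceAs (Measure.haarMeasure ⊤).IsHaarMeasure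

instance : (haar M).Regular := inferInstanceAs (Measure.haarMeasure ⊤).Regular

instance : IsProbabilityMeasure (haar M) := ⟨Measure.haarMeasure_self⟩

theorem exists_dualGroup_apply_ne_one {m : M} (hm : m ≠ 0) :
    ∃ x : DualGroup M, x (Multiplicative.ofAdd m) ≠ 1 := by
  obtain ⟨f, hf⟩ := exists_circleHom_ne_one hm
  exact ⟨(⟨f, continuous_of_discreteTopology⟩ : Multiplicative M →ₜ* Circle), hf⟩

/-- Translating by some `y` with `y m ≠ 1` multiplies the integral by `y m`, yet Haar measure is
invariant. -/
theorem integral_evalChar {m : M} (hm : m ≠ 0) : ∫ x, evalChar m x ∂haar M = 0 := by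
  obtain ⟨y, hy⟩ := exists_dualGroup_apply_ne_one hm
  have h := integral_mul_left_eq_self (μ := haar M) (fun x => evalChar m x) y
  have hmul (x : DualGroup M) : evalChar m (y * x) = evalChar m y * evalChar m x := by
    rw [evalChar_apply, evalChar_apply, evalChar_apply, ← Circle.coe_mul]
    rfl
  simp_rw [hmul] at h
  rw [integral_const_mul] at h
  have h1 : evalChar m y ≠ 1 := fun h1 => hy (Circle.ext h1)
  by_contra h0
  exact h1 (mul_right_cancel₀ h0 (by rw [h, one_mul]))

/-- The evaluation character at `m`, as an element of `L²`. -/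
noncomputable def evalCharLp (m : M) : Lp ℂ 2 (haar M) :=
  ContinuousMap.toLp (E := ℂ) 2 (haar M) ℂ (evalChar m)

theorem coeFn_evalCharLp (m : M) : evalCharLp m =ᵐ[haar M] evalChar m :=
  ContinuousMap.coeFn_toLp (haar M) (evalChar m)

theorem orthonormal_evalCharLp : Orthonormal ℂ (evalCharLp (M := M)) := by
  classical
  rw [orthonormal_iff_ite]
  intro i j
  rw [evalCharLp, evalCharLp, ContinuousMap.inner_toLp (haar M) (evalChar i) (evalChar j)]
  have h (x : DualGroup M) :
      evalChar j x * (starRingEnd ℂ) (evalChar i x) = evalChar (j - i) x := by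
    rw [sub_eq_add_neg, evalChar_add, evalChar_neg]
    rfl
  simp_rw [h]
  split_ifs with hij
  · simp [hij, evalChar_zero]
  · exact integral_evalChar (sub_ne_zero.2 (Ne.symm hij))

theorem span_evalCharLp_dense :
    Dense (Submodule.span ℂ (Set.range (evalCharLp (M := M))) : Set (Lp ℂ 2 (haar M))) := by
  rw [Submodule.dense_iff_topologicalClosure_eq_top]
  convert! (ContinuousMap.toLp_denseRange ℂ (haar M) ℂ
    (p := 2) (by simp)).topologicalClosure_map_submodule span_evalChar_closure_eq_top
  rw [Submodule.map_span, ← Set.range_comp]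
  rfl

/-- The evaluation characters are orthonormal with dense span, so subtracting the trivial component
leaves a vector orthogonal to everything. -/
theorem eq_smul_of_inner_evalCharLp_eq_zero (v : Lp ℂ 2 (haar M))
    (hv : ∀ m : M, m ≠ 0 → inner ℂ v (evalCharLp m) = 0) :
    ∃ c : ℂ, v = c • evalCharLp 0 := by
  refine ⟨inner ℂ (evalCharLp 0) v, sub_eq_zero.1 ?_⟩
  refine span_evalCharLp_dense.eq_zero_of_inner_left ℂ fun w hw => ?_
  induction hw using Submodule.span_induction with
  | mem w hw =>
    obtain ⟨m, rfl⟩ := hw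
    rw [inner_sub_left, inner_smul_left]
    by_cases hm : m = 0
    · subst hm
      rw [inner_self_eq_norm_sq_to_K, orthonormal_evalCharLp.1 0]
      simp
    · rw [hv m hm, orthonormal_evalCharLp.2 (Ne.symm hm)]
      simp
  | zero => simp
  | add a b _ _ ha hb => rw [inner_add_right, ha, hb, add_zero]
  | smul c a _ ha => rw [inner_smul_right, ha, mul_zero]

end DualGroup

/-! ### Dictionary between the dynamics and the module. -/

section Ergodicity

variable {d : ℕ} {M : Type*} [AddCommGroup M] [Module (LaurentRing d) M]
  [TopologicalSpace M] [DiscreteTopology M]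

theorem monomial_nsmul (n : Fin d → ℤ) (k : ℕ) : monomial (k • n) = monomial n ^ k := by
  simp [monomial, AddMonoidAlgebra.single_pow]

theorem monomial_smul_injective {M : Type*} [AddCommGroup M] [Module (LaurentRing d) M]
    (n : Fin d → ℤ) :
    Function.Injective fun m : M => monomial n • m := by
  intro m m' h
  have h' := congrArg (fun a : M => monomial (-n) • a) h
  simpa [smul_smul, ← monomial_add, monomial_zero] using h'

theorem measurePreserving_alpha (n : Fin d → ℤ) :
    MeasurePreserving (alpha M n) (haar M) (haar M) :=
  MonoidHom.measurePreserving (f := (alpha M n).toMulEquiv.toMonoidHom)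
    (alpha M n).continuous_toFun (alpha M n).surjective rfl

theorem setIntegral_evalChar_monomial_smul (n : Fin d → ℤ) {s : Set (DualGroup M)}
    (hs : alpha M n ⁻¹' s = s) (m : M) :
    ∫ x in s, evalChar (monomial n • m) x ∂haar M = ∫ x in s, evalChar m x ∂haar M := by
  have h := (measurePreserving_alpha (M := M) n).setIntegral_preimage_emb
    (alpha M n).toHomeomorph.measurableEmbedding (evalChar m) s
  rw [hs] at h
  exact h

/-- The automorphism `α_M^n` is ergodic if multiplication by `u^n` has no nonzero periodic point
in `M`. -/
theorem ergodic_alpha_of_forall_pow_smul_ne (n : Fin d → ℤ)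
    (hn : ∀ j : ℕ, 1 ≤ j → ∀ m : M, m ≠ 0 → monomial n ^ j • m ≠ m) :
    Ergodic (alpha M n) (haar M) := by
  refine { measurePreserving_alpha n with aeconst_set := fun s hs hinv => ?_ }
  set v := indicatorConstLp 2 hs (measure_ne_top (haar M) s) (1 : ℂ) with hvdef
  have hv (m : M) : inner ℂ v (evalCharLp m) = ∫ x in s, evalChar m x ∂haar M := by
    rw [hvdef, L2.inner_indicatorConstLp_one]
    exact integral_congr_ae (ae_restrict_of_ae (coeFn_evalCharLp m))
  have hzero (m : M) (hm : m ≠ 0) : inner ℂ v (evalCharLp m) = 0 := by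
    -- A coincidence at times `a < b` would, after cancelling the invertible `u^{an}`, make `m`
    -- periodic.
    have hinj : Function.Injective fun k : ℕ => monomial n ^ k • m := by
      intro a b h
      by_contra hne
      wlog hab : a < b generalizing a b
      · exact this h.symm (Ne.symm hne) (by omega)
      refine hn (b - a) (by omega) m hm ?_
      apply monomial_smul_injective (a • n)
      simp only [monomial_nsmul, smul_smul, ← pow_add]
      rw [Nat.add_sub_cancel' hab.le]
      exact h.symm
    have hconst (k : ℕ) :
        inner ℂ v (evalCharLp (monomial n ^ k • m)) = inner ℂ v (evalCharLp m) := by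
      induction k with
      | zero => simp
      | succ k ih =>
        rw [← ih, pow_succ', mul_smul, hv, hv, setIntegral_evalChar_monomial_smul n hinv]
    -- By Bessel, the coefficients along the infinite orbit are square-summable; being equal, they
    -- vanish.
    have hsum := (orthonormal_evalCharLp.comp _ hinj).inner_products_summable v
    have h0 := hsum.tendsto_atTop_zero
    simp only [Function.comp_apply, norm_inner_symm _ v, hconst] at h0
    have := tendsto_nhds_unique h0 tendsto_const_nhds
    simpa using this.symm
  obtain ⟨c, hc⟩ := eq_smul_of_inner_evalCharLp_eq_zero v hzero
  have hae : s.indicator (fun _ => (1 : ℂ)) =ᵐ[haar M] fun _ => c := by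
    have h1 : v =ᵐ[haar M] s.indicator fun _ => (1 : ℂ) := indicatorConstLp_coeFn
    have h2 : v =ᵐ[haar M] c • ⇑(evalCharLp (0 : M)) := by
      rw [hc]
      exact Lp.coeFn_smul c _
    filter_upwards [h1, h2, coeFn_evalCharLp (0 : M)] with x hx1 hx2 hx3
    rw [← hx1, hx2, Pi.smul_apply, hx3, evalChar_zero]
    simp
  rw [Filter.eventuallyConst_set]
  by_cases h1 : c = 1
  · left
    filter_upwards [hae] with x hx
    by_contra hxs
    simp [Set.indicator_of_notMem hxs, h1] at hx
  · right
    filter_upwards [hae] with x hx hxs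
    rw [Set.indicator_of_mem hxs] at hx
    exact h1 hx.symm

/-- If the action is ergodic then `M` has no nonzero finite submodule. -/
theorem IsErgodicAction.eq_bot_of_finite (hErg : IsErgodicAction d M)
    (N : Submodule (LaurentRing d) M) [Finite N] : N = ⊥ := by
  rw [Submodule.eq_bot_iff]
  intro m hm
  by_contra hm0
  -- The annihilator of `N`.
  set s : Set (DualGroup M) := ⋂ a : N, {x | x (Multiplicative.ofAdd (a : M)) = 1} with hsdef
  have hmem (x : DualGroup M) :
      x ∈ s ↔ ∀ a ∈ N, x (Multiplicative.ofAdd a) = 1 := by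
    simp [hsdef]
  have hclosed : IsClosed s :=
    isClosed_iInter fun a => isClosed_eq (continuous_dualGroup_apply _) continuous_const
  have hopen : IsOpen s := by
    refine isOpen_iInter_of_finite fun a => ?_
    -- On `N` characters take values in the finite set of `Nat.card N`-th roots of unity, so `x a =
    -- 1` amounts to avoiding finitely many points, an open condition.
    have hfin := (finite_circle_pow_eq_one (Nat.card_pos (α := N))).subset
      (Set.sdiff_subset (t := {1}))
    convert! hfin.isClosed.isOpen_compl.preimage (continuous_dualGroup_apply (a : M)) using 1
    ext x
    have hx : x (Multiplicative.ofAdd (a : M)) ^ Nat.card N = 1 := by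
      have ha : Nat.card N • (a : M) = 0 := congrArg Subtype.val (card_nsmul_eq_zero' (x := a))
      rw [← map_pow, ← ofAdd_nsmul, ha, ofAdd_zero, map_one]
    simp [hx]
  obtain ⟨y, hy⟩ := exists_dualGroup_apply_ne_one hm0
  have hinv (n : Fin d → ℤ) : alpha M n ⁻¹' s = s := by
    ext x
    rw [Set.mem_preimage, hmem, hmem]
    refine ⟨fun h a ha => ?_, fun h a ha => h _ (N.smul_mem _ ha)⟩
    have := h _ (N.smul_mem (monomial (-n)) ha)
    rwa [alpha_apply, smul_smul, ← monomial_add, add_neg_cancel, monomial_zero, one_smul] at this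
  rcases hErg s hclosed.measurableSet hinv with h | h
  · exact (hopen.measure_pos (haar M) ⟨1, (hmem 1).2 fun _ _ => rfl⟩).ne' h
  · exact (hclosed.isOpen_compl.measure_pos (haar M) ⟨y, fun hys => hy ((hmem y).1 hys m hm)⟩).ne' h

theorem alpha_iterate_apply (n : Fin d → ℤ) (j : ℕ) (x : DualGroup M) (m : M) :
    (alpha M n)^[j] x (Multiplicative.ofAdd m) =
      x (Multiplicative.ofAdd (monomial n ^ j • m)) := by
  induction j generalizing m with
  | zero => simp
  | succ j ih => rw [Function.iterate_succ_apply', alpha_apply, ih, smul_smul, pow_succ]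

/-- If `α_M^n` has finitely many points of period `j` then `(u^{jn} - 1) M` has finite index. -/
theorem finite_quotient_of_finite_ptsOfPeriod (n : Fin d → ℤ) (j : ℕ)
    (h : (Function.ptsOfPeriod (alpha M n) j).Finite) :
    Finite (M ⧸ (LinearMap.lsmul (LaurentRing d) M (monomial n ^ j - 1)).range) := by
  set f := LinearMap.lsmul (LaurentRing d) M (monomial n ^ j - 1) with hf
  have := h.to_subtype
  -- Inflation along `M → M ⧸ f.range` embeds the characters of the quotient into the points of
  -- period `j`.
  let F (χ : Multiplicative (M ⧸ f.range) →* Circle) : DualGroup M :=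
    (⟨χ.comp f.range.mkQ.toAddMonoidHom.toMultiplicative, continuous_of_discreteTopology⟩ :
      Multiplicative M →ₜ* Circle)
  have hF (χ) (m : M) :
      F χ (Multiplicative.ofAdd m) = χ (Multiplicative.ofAdd (f.range.mkQ m)) := rfl
  have hper (χ) : F χ ∈ Function.ptsOfPeriod (alpha M n) j := by
    refine PontryaginDual.ext fun a => ?_
    obtain ⟨m, rfl⟩ := Multiplicative.ofAdd.surjective a
    rw [alpha_iterate_apply, hF, hF]
    congr 2
    rw [← sub_eq_zero, ← map_sub, Submodule.mkQ_apply, Submodule.Quotient.mk_eq_zero]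
    exact ⟨m, by simp [hf]⟩
  have : Finite (Multiplicative (M ⧸ f.range) →* Circle) := by
    refine Finite.of_injective
      (fun χ => (⟨F χ, hper χ⟩ : Function.ptsOfPeriod (alpha M n) j)) fun χ χ' hχ => ?_
    refine MonoidHom.ext fun a => ?_
    obtain ⟨m, hm⟩ := f.range.mkQ_surjective a.toAdd
    have := DFunLike.congr_fun (congrArg Subtype.val hχ) (Multiplicative.ofAdd m)
    rw [hF, hF, hm] at this
    exact this
  exact finite_of_finite_circleHom

end Ergodicity

/-! ### Finite cokernel forces finite kernel, and the conclusion. -/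

/-- An endomorphism of a Noetherian module whose range has finite index has finite kernel. -/
theorem finite_ker_of_finite_quotient_range {R M : Type*} [CommRing R] [AddCommGroup M]
    [Module R M] [IsNoetherian R M] (f : Module.End R M) [Finite (M ⧸ f.range)] :
    Finite f.ker := by
  have hindex (k : ℕ) : (f ^ k).range.toAddSubgroup.FiniteIndex := by
    induction k with
    | zero =>
      rw [pow_zero, Module.End.one_eq_id, LinearMap.range_id]
      exact inferInstanceAs (⊤ : AddSubgroup M).FiniteIndex
    | succ k ih =>
      have h1 : f.range.toAddSubgroup.FiniteIndex :=
        @AddSubgroup.finiteIndex_of_finite_quotient _ _ f.range.toAddSubgroup ‹_›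
      have h2 : (f ^ (k + 1)).range.toAddSubgroup =
          (f ^ k).range.toAddSubgroup.map f.toAddMonoidHom := by
        rw [pow_succ', Module.End.mul_eq_comp, LinearMap.range_comp]
        rfl
      have h3 := AddSubgroup.finiteIndex_of_le
        (le_sup_left : (f ^ k).range.toAddSubgroup ≤ _ ⊔ f.toAddMonoidHom.ker)
      refine ⟨?_⟩
      -- The index of `f(H)` is that of `H ⊔ ker f` times that of `range f`.
      rw [h2, AddSubgroup.index_map]
      exact mul_ne_zero h3.index_ne_zero h1.index_ne_zero
  -- Fitting: for large `k` the kernel of `f ^ k` meets its range trivially, so `ker f`, contained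
  -- in `ker (f ^ k)` as `k ≥ 1`, embeds in the finite quotient by that range.
  obtain ⟨k, hdisj, hk⟩ := (f.eventually_disjoint_ker_pow_range_pow.and
    (Filter.eventually_ge_atTop 1)).exists
  have hfin : Finite (M ⧸ (f ^ k).range) :=
    @AddSubgroup.finite_quotient_of_finiteIndex _ _ (f ^ k).range.toAddSubgroup (hindex k)
  have hle : f.ker ≤ (f ^ k).ker := fun m hm => by
    rw [LinearMap.mem_ker] at hm ⊢
    obtain ⟨l, rfl⟩ := Nat.exists_eq_add_of_le' hk
    rw [pow_succ, Module.End.mul_apply, hm, map_zero]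
  refine Finite.of_injective ((f ^ k).range.mkQ.comp f.ker.subtype) ?_
  rw [← LinearMap.ker_eq_bot, LinearMap.ker_comp, Submodule.ker_mkQ, Submodule.eq_bot_iff]
  intro m hm
  exact Subtype.ext (Submodule.disjoint_def.1 hdisj m (hle m.2) hm)

end AlgebraicAction

theorem mainTheorem4 (d : ℕ) (M : Type*) [AddCommGroup M]
    [Module (AlgebraicAction.LaurentRing d) M]
    [TopologicalSpace M] [DiscreteTopology M]
    (hNoeth : IsNoetherian (AlgebraicAction.LaurentRing d) M)
    (hErg : AlgebraicAction.IsErgodicAction d M)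
    (n : Fin d → ℤ)
    (hFin : ∀ j : ℕ, 1 ≤ j →
      (Function.ptsOfPeriod (AlgebraicAction.alpha M n) j).Finite) :
    Ergodic (AlgebraicAction.alpha M n) (AlgebraicAction.haar M) := by
  refine AlgebraicAction.ergodic_alpha_of_forall_pow_smul_ne n fun j hj m hm h => hm ?_
  have := AlgebraicAction.finite_quotient_of_finite_ptsOfPeriod n j (hFin j hj)
  have := AlgebraicAction.finite_ker_of_finite_quotient_range
    (LinearMap.lsmul (AlgebraicAction.LaurentRing d) M (AlgebraicAction.monomial n ^ j - 1))
  have hbot := hErg.eq_bot_of_finite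
    (LinearMap.lsmul (AlgebraicAction.LaurentRing d) M (AlgebraicAction.monomial n ^ j - 1)).ker
  rw [Submodule.eq_bot_iff] at hbot
  exact hbot m (by simp [h])
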